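/- Let $K$ be a field, $n\ge 1$ an integer, and let $D_n$ be the dihedral group of order $2n$. For a faithful finite-dimensional representation $V$ of a finite group $G$ over $K$, let $K(V)$ be the field of rational functions on $V$ with the induced action of $G$, and put $$\mathrm{ed}_K(G)=\min\{\mathrm{trdeg}_K E : K\subseteq E\subseteq K(V)\text{ a } G\text{-stable subfield on which } G \text{ acts faithfully}\};$$ this number does not depend on the choice of $V$. Write "$\zeta_n+\zeta_n^{-1}\in K$" for: $\operatorname{char} K\nmid n$ and $\zeta_n+\zeta_n^{-1}\in K$ for a primitive $n$-th root of unity $\zeta_n$ in an algebraic closure of $K$ (where $\operatorname{char}K\nmid n$ holds by convention if $\operatorname{char}K=0$). (1) If $\operatorname{char} K=0$, then $\mathrm{ed}_K(D_n)=1$ if and only if $n$ is odd and $\zeta_n+\zeta_n^{-1}\in K$. (2) If $\operatorname{char} K=p>0$ and $p\neq 2$, then $\mathrm{ed}_K(D_n)=1$ if and only if $n$ is odd and: $\zeta_n+\zeta_n^{-1}\in K$ in case $p\nmid n$, and $n=p$ in case $p\mid n$. (3) If $\operatorname{char} K=2$, then $\mathrm{ed}_K(D_n)=1$ if and only if either $n$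 is odd and $\zeta_n+\zeta_n^{-1}\in K$, or $n=2$ and $|K|\ge 4$. -/

import Mathlib

universe u v w

noncomputable section

namespace EssDim

variable {K : Type u} [Field K] {G : Type w} [Group G]
  {V : Type v} [AddCommGroup V] [Module K V]

/-- The coordinate ring `K[V]`: the symmetric algebra of the dual space of `V`. For `V` of
dimension `d` it is a polynomial ring in `d` variables, the elements of a basis of the dual. -/
abbrev CoordinateRing (K : Type u) [Field K] (V : Type v) [AddCommGroup V] [Module K V] :
    Type (max u v) :=
  SymmetricAlgebra K (Module.Dual K V)

/-- The rational function field `K(V)`. -/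
abbrev FunctionField (K : Type u) [Field K] (V : Type v) [AddCommGroup V] [Module K V] :
    Type (max u v) :=
  FractionRing (CoordinateRing K V)

/-- The action of `G` on `K[V]` by algebra endomorphisms that extends the contragredient action
`(g • f) x = f (g⁻¹ • x)` on linear forms. -/
def coordEnd (ρ : Representation K G V) : G →* (CoordinateRing K V →ₐ[K] CoordinateRing K V) where
  toFun g := SymmetricAlgebra.lift (SymmetricAlgebra.ι K (Module.Dual K V) ∘ₗ ρ.dual g)
  map_one' := by
    refine SymmetricAlgebra.algHom_ext (LinearMap.ext fun f => ?_)
    refine (SymmetricAlgebra.lift_ι_apply _ f).trans ?_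
    rw [map_one]
    rfl
  map_mul' g h := by
    refine SymmetricAlgebra.algHom_ext (LinearMap.ext fun f => ?_)
    refine (SymmetricAlgebra.lift_ι_apply _ f).trans ?_
    rw [map_mul]
    refine Eq.symm ((congrArg
      (SymmetricAlgebra.lift (SymmetricAlgebra.ι K (Module.Dual K V) ∘ₗ ρ.dual g))
      (SymmetricAlgebra.lift_ι_apply _ f)).trans ?_)
    exact SymmetricAlgebra.lift_ι_apply _ (ρ.dual h f)

/-- The action of `G` on `K[V]` by algebra automorphisms. -/
def coordAut (ρ : Representation K G V) : G →* (CoordinateRing K V ≃ₐ[K] CoordinateRing K V) :=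
  (AlgEquiv.algHomUnitsEquiv K (CoordinateRing K V)).toMonoidHom.comp (coordEnd ρ).toHomUnits

/-- The action of `G` on `K(V)` by `K`-automorphisms. -/
def fieldAut (ρ : Representation K G V) : G →* (FunctionField K V ≃ₐ[K] FunctionField K V) :=
  (IsFractionRing.fieldEquivOfAlgEquivHom K (FunctionField K V)).comp (coordAut ρ)

/-- The subfield `E` of `K(V)`, which contains `K`, is a faithful `G`-subfield: it is mapped into
itself by `G`, and only `1 : G` acts trivially on it. -/
structure IsFaithfulGSubfield (ρ : Representation K G V)
    (E : IntermediateField K (FunctionField K V)) : Prop where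
  stable : ∀ g : G, ∀ x ∈ E, fieldAut ρ g x ∈ E
  faithful : ∀ g : G, (∀ x ∈ E, fieldAut ρ g x = x) → g = 1

/-- The essential dimension computed with the representation `ρ`: the least transcendence degree
over `K` of a faithful `G`-subfield of `K(V)`. (For faithful `ρ` the set is nonempty, see
`isFaithfulGSubfield_top`, and cardinals are well ordered, so the infimum is a minimum.) -/
def ed (ρ : Representation K G V) : Cardinal.{max u v} :=
  sInf {d | ∃ E : IntermediateField K (FunctionField K V),
    IsFaithfulGSubfield ρ E ∧ d = Algebra.trdeg K E}

/-- `K(V)` itself is a faithful `G`-subfield when `ρ` is faithful. -/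
theorem isFaithfulGSubfield_top (ρ : Representation K G V) (hρ : Function.Injective ρ) :
    IsFaithfulGSubfield ρ ⊤ where
  stable _ _ _ := IntermediateField.mem_top
  faithful g hg := by
    have key : ∀ f : Module.Dual K V, ρ.dual g f = f := by
      intro f
      have h1 := hg (algebraMap (CoordinateRing K V) _ (SymmetricAlgebra.ι K _ f))
        IntermediateField.mem_top
      have h2 : fieldAut ρ g (algebraMap (CoordinateRing K V) _ (SymmetricAlgebra.ι K _ f)) =
          algebraMap (CoordinateRing K V) _ (SymmetricAlgebra.ι K _ (ρ.dual g f)) := by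
        refine (IsFractionRing.fieldEquivOfAlgEquiv_algebraMap K _ _ (coordAut ρ g) _).trans ?_
        congr 1
        exact SymmetricAlgebra.lift_ι_apply _ _
      rw [h2] at h1
      have h3 := IsFractionRing.injective (CoordinateRing K V) (FunctionField K V) h1
      have h4 := congrArg (fun a => TrivSqZeroExt.snd (SymmetricAlgebra.lift
        (TrivSqZeroExt.inrHom K (Module.Dual K V)) a)) h3
      simpa [SymmetricAlgebra.lift_ι_apply] using h4
    have h5 : ρ g⁻¹ = 1 := by
      ext v
      rw [← sub_eq_zero, ← Module.forall_dual_apply_eq_zero_iff K]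
      intro f
      have := LinearMap.congr_fun (key f) v
      simpa [Module.Dual.transpose_apply, sub_eq_zero] using this
    have h6 : g⁻¹ = 1 := hρ (h5.trans (map_one ρ).symm)
    simpa using h6

/-- `ζₙ + ζₙ⁻¹ ∈ K` for a primitive `n`-th root of unity `ζₙ` in an algebraic closure of `K`. The
existence of `ζₙ`, that is `char K ∤ n`, is part of the condition. -/
def ZetaAddInvMem (K : Type u) [Field K] (n : ℕ) : Prop :=
  ∃ ζ : AlgebraicClosure K, IsPrimitiveRoot ζ n ∧
    ∃ a : K, algebraMap K (AlgebraicClosure K) a = ζ + ζ⁻¹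

end EssDim

end

/-! For a nontrivial finite group G, essential dimension one is equivalent to the existence of a
homomorphism from G to 2×2 matrices over K in which only the identity is scalar (`ed_eq_one_iff`).
The rest is matrix computation in the dihedral group.

From a faithful subfield to matrices: a finite G-stable set already generates a subfield with
faithful action. Having transcendence degree one, it specializes injectively into K(X), so by Lüroth
it is K(x), and G acts on x by Möbius maps. In general this gives only a projective representation.
Here x is a reduced fraction p/q in K[V], a factorial ring whose units are constants, so each g maps
p and q to combinations of p and q with one common constant factor. Hence G acts linearly on the
span of p and q.

From matrices to a subfield: an element of K(V) with linearly independent conjugates yields two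
functions that transform by the matrices; their quotient generates the subfield. Degree zero is
impossible because K is algebraically closed in K(V).

Necessity for dihedral groups: the commutant of a nonscalar 2×2 matrix A is spanned by 1 and A.
Applied to the central involution (n even), this excludes even n in characteristic other than 2 and
bounds |K| for n = 2 in characteristic 2. Applied to a rotation of order p, with Frobenius, it gives
n = p. If n is odd and nonzero in K, the generating rotation has determinant 1 and a primitive n-th
root of unity as eigenvalue, so its trace is ζ + ζ⁻¹. Sufficiency is by explicit matrices. -/

namespace EssDim

/-! ### Specialization of polynomial rings to one variable -/

section

open Polynomial

/-- Both sums are base-b expansions with d digits, and such expansions are unique. -/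
theorem kronecker_exponent_injOn (d b : ℕ) (hb : 1 < b) {m m' : Fin d →₀ ℕ}
    (hm : ∀ i, m i < b) (hm' : ∀ i, m' i < b)
    (h : ∑ i : Fin d, b ^ (i : ℕ) * m i = ∑ i : Fin d, b ^ (i : ℕ) * m' i) : m = m' := by
  have key : List.ofFn m = List.ofFn m' := by
    refine Nat.ofDigits_inj_of_len_eq hb (by simp) ?_ ?_ ?_
    · simpa [List.mem_ofFn] using hm
    · simpa [List.mem_ofFn] using hm'
    · simpa [Nat.ofDigits_eq_sum_mapIdx, List.mapIdx_eq_ofFn, List.sum_ofFn, mul_comm] using h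
  exact DFunLike.coe_injective (List.ofFn_injective key)

/-- Kronecker substitution: polynomials of bounded degree embed into one variable. -/
theorem exists_algHom_injOn_totalDegree_lt (K : Type u) [Field K] (d N : ℕ) :
    ∃ φ : MvPolynomial (Fin d) K →ₐ[K] K[X],
      ∀ p : MvPolynomial (Fin d) K, p.totalDegree < N → φ p = 0 → p = 0 := by
  -- The base N + 2 exceeds every exponent that occurs, and exceeds 1 even when N = 0.
  refine ⟨MvPolynomial.aeval fun i => X ^ ((N + 2) ^ (i : ℕ)), fun p hp h0 => ?_⟩
  have lt : ∀ m ∈ p.support, ∀ i, m i < N + 2 := fun m hm i => by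
    have h1 := MvPolynomial.le_totalDegree hm
    have h2 : m i ≤ m.sum fun _ e => e := by
      by_cases hi : i ∈ m.support
      · exact Finset.single_le_sum (f := fun i => m i) (fun _ _ => Nat.zero_le _) hi
      · simp [Finsupp.notMem_support_iff.mp hi]
    omega
  ext m
  by_contra hm
  rw [MvPolynomial.coeff_zero, ← Ne, ← MvPolynomial.mem_support_iff] at hm
  have h1 := congrArg (fun q => coeff q (∑ i : Fin d, (N + 2) ^ (i : ℕ) * m i)) h0
  simp only [MvPolynomial.aeval_def, MvPolynomial.eval₂_eq', ← pow_mul, Finset.prod_pow_eq_pow_sum,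
    finsetSum_coeff, algebraMap_eq, coeff_C_mul_X_pow, coeff_zero] at h1
  rw [Finset.sum_eq_single m] at h1
  · simp at h1
    exact MvPolynomial.mem_support_iff.mp hm h1
  · intro m' hm' hne
    rw [if_neg]
    intro h
    exact hne (kronecker_exponent_injOn d (N + 2) (by omega) (lt m' hm') (lt m hm) h.symm)
  · exact fun h => (h hm).elim

/-- Finitely many elements of a polynomial ring stay linearly independent, as far as they were,
under a suitable homomorphism to polynomials in one variable. -/
theorem exists_algHom_injOn_span {K : Type u} [Field K] {A : Type v} [CommRing A] [Algebra K A]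
    {d : ℕ} (e : A ≃ₐ[K] MvPolynomial (Fin d) K) (a b : A) :
    ∃ φ : A →ₐ[K] K[X], ∀ s t : K, φ (s • a + t • b) = 0 → s • a + t • b = 0 := by
  obtain ⟨φ, hφ⟩ := exists_algHom_injOn_totalDegree_lt K d
    (max (e a).totalDegree (e b).totalDegree + 1)
  refine ⟨φ.comp e.toAlgHom, fun s t h => e.injective ?_⟩
  rw [map_zero]
  refine hφ _ ?_ h
  rw [map_add, map_smul, map_smul]
  refine Nat.lt_succ_of_le ((MvPolynomial.totalDegree_add _ _).trans (max_le_max ?_ ?_)) <;>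
  exact MvPolynomial.totalDegree_smul_le _ _

theorem mem_range_of_isAlgebraic_ratFunc {K : Type u} [Field K] {x : RatFunc K}
    (hx : IsAlgebraic K x) : ∃ c : K, algebraMap K (RatFunc K) c = x := by
  by_contra h
  refine RatFunc.transcendental_of_ne_C x (fun ⟨c, hc⟩ => h ⟨c, ?_⟩) hx
  rw [hc]; rfl

/-- The base field is algebraically closed in a rational function field. -/
theorem mem_range_of_isAlgebraic {K : Type u} [Field K] {A : Type v} [CommRing A] [IsDomain A]
    [Algebra K A] [IsIntegrallyClosed A] {F : Type w} [Field F] [Algebra K F] [Algebra A F]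
    [IsScalarTower K A F] [IsFractionRing A F]
    {d : ℕ} (e : A ≃ₐ[K] MvPolynomial (Fin d) K) {x : F} (hx : IsAlgebraic K x) :
    ∃ c : K, algebraMap K F c = x := by
  -- Algebraic over K implies integral over A, so x lies in the integrally closed ring A.
  obtain ⟨a, rfl⟩ := (IsIntegrallyClosed.isIntegral_iff (R := A)).mp (hx.isIntegral.tower_top (A := A))
  have ha : IsAlgebraic K a := (isAlgebraic_algebraMap_iff (IsFractionRing.injective A F)).mp hx
  obtain ⟨φ, hφ⟩ := exists_algHom_injOn_span e a 1
  obtain ⟨c, hc⟩ := mem_range_of_isAlgebraic_ratFunc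
    ((ha.algHom φ).algHom (Algebra.algHom K K[X] (RatFunc K)))
  refine ⟨c, ?_⟩
  have h2 : φ a = C c := by
    apply IsFractionRing.injective K[X] (RatFunc K)
    rw [← algebraMap_eq, ← IsScalarTower.algebraMap_apply, hc]
    rfl
  have h3 := hφ 1 (-c) (by simp [h2, Algebra.smul_def, algebraMap_eq])
  rw [one_smul, neg_smul, ← sub_eq_add_neg, sub_eq_zero] at h3
  rw [h3, Algebra.smul_def, mul_one, ← IsScalarTower.algebraMap_apply]

/-- Over a field of transcendence degree at most one, a nonzero element of a subring divides a
nonzero polynomial in any given transcendental element. -/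
theorem exists_dvd_aeval {K : Type u} [Field K] {F : Type v} [Field F] [Algebra K F]
    {E : IntermediateField K F} (hE : Algebra.trdeg K E ≤ 1) {B : Subalgebra K F}
    (hB : ∀ x ∈ B, x ∈ E) {t x : B} (ht : Transcendental K t) (hx : x ≠ 0) :
    ∃ q : K[X], q ≠ 0 ∧ x ∣ aeval t q := by
  let i : B →ₐ[K] E := Subalgebra.inclusion (T := E.toSubalgebra) hB
  have hi : Function.Injective i := Subalgebra.inclusion_injective hB
  have hind : AlgebraicIndependent K (fun _ : Unit => t) :=
    algebraicIndependent_unique_type_iff.mpr ht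
  -- Otherwise t and x would be two algebraically independent elements of E. A nonzero constant term
  -- of a relation for x is then a polynomial in t divisible by x.
  have halg : IsAlgebraic (Algebra.adjoin K (Set.range fun _ : Unit => t)) x := by
    by_contra htr
    have h2 := (hind.option_iff_transcendental x).mpr htr
    have h3 := (h2.map' (f := i) hi).lift_cardinalMk_le_trdeg
    have h4 := h3.trans (Cardinal.lift_le.mpr hE)
    simp at h4
  obtain ⟨⟨r, hr⟩, hr0, hdvd⟩ := halg.exists_nonzero_dvd (mem_nonZeroDivisors_of_ne_zero hx)
  rw [Set.range_const, Algebra.adjoin_singleton_eq_range_aeval] at hr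
  obtain ⟨q, rfl⟩ := hr
  refine ⟨q, ?_, hdvd⟩
  rintro rfl
  exact hr0 (by ext; simp)

open scoped IntermediateField.algebraAdjoinAdjoin in
/-- A finitely generated subfield of transcendence degree one of a rational function field embeds
into the rational function field in one variable. -/
theorem exists_algHom_adjoin_ratFunc {K : Type u} [Field K] {A : Type v} [CommRing A] [IsDomain A]
    [Algebra K A] {F : Type w} [Field F] [Algebra K F] [Algebra A F]
    [IsScalarTower K A F] [IsFractionRing A F]
    {d : ℕ} (e : A ≃ₐ[K] MvPolynomial (Fin d) K) {E : IntermediateField K F}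
    (hE : Algebra.trdeg K E ≤ 1) {S : Finset F} (hS : ∀ x ∈ S, x ∈ E)
    {t : F} (htS : t ∈ S) (ht : ∀ c : K, algebraMap K F c ≠ t) :
    Nonempty (IntermediateField.adjoin K (S : Set F) →ₐ[K] RatFunc K) := by
  obtain ⟨⟨b, hb⟩, hint⟩ := IsLocalization.exist_integer_multiples_of_finset (nonZeroDivisors A) S
  have hb0 : b ≠ 0 := nonZeroDivisors.ne_zero hb
  have hbF : algebraMap A F b ≠ 0 := by
    rwa [Ne, IsFractionRing.to_map_eq_zero_iff]
  obtain ⟨a, ha⟩ := hint t htS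
  replace ha : algebraMap A F a = algebraMap A F b * t := by simpa [Algebra.smul_def] using ha
  -- Injectivity on the span of a and b does two things: φ b is nonzero, so the common denominator
  -- stays invertible, and φ a / φ b, the image of t, is not constant.
  obtain ⟨φ, hφ⟩ := exists_algHom_injOn_span e a b
  have hφb : φ b ≠ 0 := fun h => hb0 (by simpa using hφ 0 1 (by simpa using h))
  let ψ₀ : A →ₐ[K] RatFunc K := (Algebra.algHom K K[X] (RatFunc K)).comp φ
  have hψ₀b : ψ₀ b ≠ 0 := by
    change algebraMap K[X] (RatFunc K) (φ b) ≠ 0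
    rwa [Ne, IsFractionRing.to_map_eq_zero_iff]
  let Ab := Localization.Away b
  have hι₀ : ∀ y : Submonoid.powers b, IsUnit (Algebra.algHom K A F y) := by
    rintro ⟨_, k, rfl⟩
    rw [map_pow]
    exact (IsUnit.mk0 _ hbF).pow k
  have hψ : ∀ y : Submonoid.powers b, IsUnit (ψ₀ y) := by
    rintro ⟨_, k, rfl⟩
    rw [map_pow]
    exact (IsUnit.mk0 _ hψ₀b).pow k
  let ι : Ab →ₐ[K] F := IsLocalization.liftAlgHom (M := Submonoid.powers b) hι₀
  let ψ : Ab →ₐ[K] RatFunc K := IsLocalization.liftAlgHom (M := Submonoid.powers b) hψ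
  have hιA : ∀ y : A, ι (algebraMap A Ab y) = algebraMap A F y := fun y =>
    IsLocalization.lift_eq _ y
  have hψA : ∀ y : A, ψ (algebraMap A Ab y) = ψ₀ y := fun y => IsLocalization.lift_eq _ y
  have hι : Function.Injective ι := by
    refine (IsLocalization.lift_injective_iff _).mpr fun x y => ?_
    change _ ↔ algebraMap A F x = algebraMap A F y
    rw [(IsLocalization.injective Ab (powers_le_nonZeroDivisors_of_noZeroDivisors hb0)).eq_iff,
      (IsFractionRing.injective A F).eq_iff]
  have hsub : Algebra.adjoin K (S : Set F) ≤ ι.range := by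
    refine Algebra.adjoin_le fun s hs => ?_
    obtain ⟨c, hc⟩ := hint s hs
    replace hc : algebraMap A F c = algebraMap A F b * s := by simpa [Algebra.smul_def] using hc
    refine ⟨IsLocalization.mk' Ab c ⟨b, Submonoid.mem_powers b⟩, ?_⟩
    have h1 := congrArg ι (IsLocalization.mk'_spec Ab c ⟨b, Submonoid.mem_powers b⟩)
    rw [map_mul, hιA, hιA, hc, mul_comm] at h1
    exact mul_left_cancel₀ hbF h1
  let θ : Algebra.adjoin K (S : Set F) →ₐ[K] Ab :=
    (AlgEquiv.ofInjective ι hι).symm.toAlgHom.comp (Subalgebra.inclusion hsub)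
  have hθ : ∀ x, ι (θ x) = x := fun x =>
    congrArg Subtype.val ((AlgEquiv.ofInjective ι hι).apply_symm_apply (Subalgebra.inclusion hsub x))
  let g := ψ.comp θ
  let t' : Algebra.adjoin K (S : Set F) := ⟨t, Algebra.subset_adjoin htS⟩
  have hgt : g t' * ψ₀ b = ψ₀ a := by
    have h1 : θ t' * algebraMap A Ab b = algebraMap A Ab a := hι (by
      rw [map_mul, hιA, hιA, hθ, ha, mul_comm])
    rw [← hψA, ← hψA, ← h1, map_mul]
    rfl
  have hgt' : Transcendental K (g t') := fun halg => by
    obtain ⟨c, hc⟩ := mem_range_of_isAlgebraic_ratFunc halg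
    rw [← hc, ← Algebra.smul_def, ← map_smul] at hgt
    have h2 : c • φ b = φ a := by
      rw [← map_smul]
      exact IsFractionRing.injective K[X] (RatFunc K) hgt
    have h3 := hφ 1 (-c) (by simp [h2])
    rw [one_smul, neg_smul, ← sub_eq_add_neg, sub_eq_zero] at h3
    rw [h3, Algebra.smul_def, map_mul, ← IsScalarTower.algebraMap_apply, mul_comm] at ha
    exact ht c (mul_left_cancel₀ hbF ha)
  -- A nonzero x in the kernel would divide some nonzero q(t), which would make the image of t a
  -- root of q.
  have hg : Function.Injective g := by
    refine (injective_iff_map_eq_zero g).mpr fun x hx => ?_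
    by_contra hx0
    obtain ⟨q, hq0, z, hz⟩ := exists_dvd_aeval hE
      (fun y hy => (Algebra.adjoin_le (S := E.toSubalgebra) hS) hy) (t := t')
      (fun h => hgt' (h.algHom g)) hx0
    refine hq0 (transcendental_iff.mp hgt' q ?_)
    rw [aeval_algHom_apply, hz, map_mul, hx, zero_mul]
  exact ⟨IsFractionRing.liftAlgHom (K := IntermediateField.adjoin K (S : Set F)) hg⟩

/-! ### Lüroth's theorem and Möbius actions -/

/-- Lüroth's theorem for abstract subfields. -/
theorem exists_algEquiv_ratFunc {K : Type u} [Field K] {L : Type v} [Field L] [Algebra K L]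
    (j : L →ₐ[K] RatFunc K) {t : L} (ht : ∀ c : K, algebraMap K L c ≠ t) :
    Nonempty (RatFunc K ≃ₐ[K] L) := by
  have hne : j.fieldRange ≠ ⊥ := fun h => by
    have h1 : j t ∈ j.fieldRange := ⟨t, rfl⟩
    rw [h, IntermediateField.mem_bot] at h1
    obtain ⟨c, hc⟩ := h1
    exact ht c ((j : L →+* RatFunc K).injective ((j.commutes c).trans hc))
  exact ⟨(RatFunc.Luroth.algEquiv hne).trans (AlgEquiv.ofInjectiveField j).symm⟩

theorem adjoin_apply_X_eq_top {K : Type u} [Field K] (τ : RatFunc K ≃ₐ[K] RatFunc K) :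
    IntermediateField.adjoin K {τ RatFunc.X} = ⊤ := by
  have h := congrArg (IntermediateField.map τ.toAlgHom) (RatFunc.adjoin_X (K := K))
  rw [IntermediateField.adjoin_map, Set.image_singleton] at h
  refine h.trans ?_
  rw [← AlgHom.fieldRange_eq_map]
  exact AlgHom.fieldRange_eq_top.mpr τ.surjective

/-- Automorphisms of `K(X)` are Möbius transformations. -/
theorem ratFunc_algEquiv_apply_X {K : Type u} [Field K] (τ : RatFunc K ≃ₐ[K] RatFunc K) :
    ∃ a b c d : K, a * d - b * c ≠ 0 ∧
      τ RatFunc.X * (algebraMap K _ c * RatFunc.X + algebraMap K _ d) =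
        algebraMap K _ a * RatFunc.X + algebraMap K _ b := by
  set x := τ RatFunc.X with hx
  -- The degree of K(X) over K(x) is the larger of the degrees of numerator and denominator; here
  -- K(x) is everything.
  have hdeg : max x.num.natDegree x.denom.natDegree = 1 := by
    rw [← RatFunc.finrank_eq_max_natDegree, adjoin_apply_X_eq_top, IntermediateField.finrank_top]
  have hn := Polynomial.eq_X_add_C_of_natDegree_le_one ((le_max_left _ _).trans hdeg.le)
  have hd := Polynomial.eq_X_add_C_of_natDegree_le_one ((le_max_right _ _).trans hdeg.le)
  set a := x.num.coeff 1
  set b := x.num.coeff 0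
  set c := x.denom.coeff 1
  set d := x.denom.coeff 0
  have hC : ∀ y : K, algebraMap K[X] (RatFunc K) (C y) = algebraMap K (RatFunc K) y := fun y => rfl
  have hn' : algebraMap K[X] (RatFunc K) x.num =
      algebraMap K _ a * RatFunc.X + algebraMap K _ b := by
    rw [hn, map_add, map_mul, hC, hC, RatFunc.algebraMap_X]
  have hd' : algebraMap K[X] (RatFunc K) x.denom =
      algebraMap K _ c * RatFunc.X + algebraMap K _ d := by
    rw [hd, map_add, map_mul, hC, hC, RatFunc.algebraMap_X]
  have hd0 : algebraMap K[X] (RatFunc K) x.denom ≠ 0 := by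
    rw [Ne, IsFractionRing.to_map_eq_zero_iff]
    exact x.denom_ne_zero
  have heq : x * (algebraMap K _ c * RatFunc.X + algebraMap K _ d) =
        algebraMap K _ a * RatFunc.X + algebraMap K _ b := by
    rw [← hn', ← hd']
    nth_rewrite 1 [← RatFunc.num_div_denom x]
    exact div_mul_cancel₀ _ hd0
  refine ⟨a, b, c, d, fun hdet => ?_, heq⟩
  have hconst : ∀ s : K, algebraMap K (RatFunc K) s ≠ x := fun s hs => by
    have h1 : τ (algebraMap K _ s) = τ RatFunc.X := by rw [AlgEquiv.commutes, hs]
    exact RatFunc.transcendental_X (K := K) (τ.injective h1 ▸ isAlgebraic_algebraMap s)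
  rw [← hd'] at heq
  have hcd : c ≠ 0 ∨ d ≠ 0 := by
    by_contra! h
    exact hd0 (by rw [hd', h.1, h.2]; simp)
  have hdet' : algebraMap K (RatFunc K) a * algebraMap K _ d =
      algebraMap K _ b * algebraMap K _ c := by
    rw [← map_mul, ← map_mul, sub_eq_zero.mp hdet]
  rcases hcd with h | h
  · have h' : algebraMap K (RatFunc K) c ≠ 0 := by simpa using h
    refine hconst (a / c) (mul_right_cancel₀ (mul_ne_zero h' hd0) ?_)
    rw [map_div₀, mul_left_comm, ← mul_assoc, ← mul_assoc, mul_div_cancel₀ _ h', mul_assoc,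
      mul_left_comm, heq, hd']
    linear_combination hdet'
  · have h' : algebraMap K (RatFunc K) d ≠ 0 := by simpa using h
    refine hconst (b / d) (mul_right_cancel₀ (mul_ne_zero h' hd0) ?_)
    rw [map_div₀, mul_left_comm, ← mul_assoc, ← mul_assoc, mul_div_cancel₀ _ h', mul_assoc,
      mul_left_comm, heq, hd']
    linear_combination -RatFunc.X * hdet'

/-- A faithful stable subfield of transcendence degree one contains a function on which the group
acts faithfully by Möbius transformations. -/
theorem exists_moebius_action {K : Type u} [Field K] {A : Type v} [CommRing A] [IsDomain A]
    [Algebra K A] {F : Type w} [Field F] [Algebra K F] [Algebra A F]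
    [IsScalarTower K A F] [IsFractionRing A F]
    {d : ℕ} (e : A ≃ₐ[K] MvPolynomial (Fin d) K) {G : Type*} [Group G] [Finite G] [Nontrivial G]
    (δ : G →* (F ≃ₐ[K] F)) {E : IntermediateField K F}
    (hE : Algebra.trdeg K E ≤ 1) (hstab : ∀ g, ∀ x ∈ E, δ g x ∈ E)
    (hfaith : ∀ g, (∀ x ∈ E, δ g x = x) → g = 1) :
    ∃ x : F, (∀ c : K, algebraMap K F c ≠ x) ∧ (∀ g, δ g x = x → g = 1) ∧
      ∀ g, ∃ a b c d : K, a * d - b * c ≠ 0 ∧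
        δ g x * (algebraMap K _ c * x + algebraMap K _ d) =
          algebraMap K _ a * x + algebraMap K _ b := by
  classical
  have := Fintype.ofFinite G
  have hmove : ∀ g : G, ∃ x ∈ E, δ g x = x → g = 1 := fun g => by
    by_contra! h
    obtain ⟨h1, h2⟩ := h 0 (zero_mem E)
    exact h2 (hfaith g fun x hx => (h x hx).1)
  choose m hmE hm using hmove
  -- For each g, `m g` witnesses that g acts nontrivially unless g = 1; all translates are taken so
  -- that S is G-stable.
  let S : Finset F := (Finset.univ : Finset (G × G)).image fun p => δ p.1 (m p.2)
  have hS : ∀ x ∈ S, x ∈ E := fun x hx => by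
    obtain ⟨p, -, rfl⟩ := Finset.mem_image.mp hx
    exact hstab _ _ (hmE _)
  have hmS : ∀ g, m g ∈ S := fun g => Finset.mem_image.mpr ⟨(1, g), Finset.mem_univ _, by simp⟩
  have hδS : ∀ g, ∀ x ∈ S, δ g x ∈ S := fun g x hx => by
    obtain ⟨p, -, rfl⟩ := Finset.mem_image.mp hx
    exact Finset.mem_image.mpr ⟨(g * p.1, p.2), Finset.mem_univ _, by simp⟩
  obtain ⟨g₀, hg₀⟩ := exists_ne (1 : G)
  have ht : ∀ c : K, algebraMap K F c ≠ m g₀ := fun c hc =>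
    hg₀ (hm g₀ (by rw [← hc, AlgEquiv.commutes]))
  obtain ⟨j⟩ := exists_algHom_adjoin_ratFunc e hE hS (hmS g₀) ht
  set L := IntermediateField.adjoin K (S : Set F) with hL
  have hmL : ∀ g, m g ∈ L := fun g => IntermediateField.subset_adjoin K _ (hmS g)
  obtain ⟨ε⟩ := exists_algEquiv_ratFunc j (t := ⟨m g₀, hmL g₀⟩)
    fun c hc => ht c (congrArg Subtype.val hc)
  have hδL : ∀ g, ∀ x ∈ L, δ g x ∈ L := fun g x hx => by
    have h1 : L ≤ L.comap (δ g).toAlgHom :=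
      IntermediateField.adjoin_le_iff.mpr fun y hy =>
        IntermediateField.subset_adjoin K _ (hδS g y hy)
    exact h1 hx
  let σ : G → (L →ₐ[K] L) := fun g =>
    ((δ g).toAlgHom.comp L.val).codRestrict L.toSubalgebra fun x => hδL g x x.2
  have hσ : ∀ g x, (σ g x : F) = δ g x := fun _ _ => rfl
  have hσσ : ∀ g g' : G, g * g' = 1 → (σ g).comp (σ g') = AlgHom.id K L := fun g g' h => by
    ext x
    change δ g (δ g' x) = x
    rw [← AlgEquiv.mul_apply, ← map_mul, h, map_one, AlgEquiv.one_apply]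
  let σe : G → (L ≃ₐ[K] L) := fun g =>
    AlgEquiv.ofAlgHom (σ g) (σ g⁻¹) (hσσ _ _ (mul_inv_cancel g)) (hσσ _ _ (inv_mul_cancel g))
  let τ : G → (RatFunc K ≃ₐ[K] RatFunc K) := fun g => (ε.trans (σe g)).trans ε.symm
  have hτ : ∀ g y, (ε (τ g y) : F) = δ g (ε y) := fun g y => by
    simp only [τ, AlgEquiv.trans_apply, AlgEquiv.apply_symm_apply]
    rfl
  refine ⟨ε RatFunc.X, fun c hc => ?_, fun g hg => hm g ?_, fun g => ?_⟩
  · have h1 : ε (algebraMap K _ c) = ε RatFunc.X := Subtype.ext (by rw [AlgEquiv.commutes]; exact hc)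
    exact RatFunc.transcendental_X (K := K) (ε.injective h1 ▸ isAlgebraic_algebraMap c)
  · have h1 : τ g RatFunc.X = RatFunc.X := ε.injective (Subtype.ext ((hτ _ _).trans hg))
    have h2 : ∀ y, τ g y = y := fun y => by
      have hy : y ∈ IntermediateField.adjoin K {(RatFunc.X : RatFunc K)} := by
        rw [RatFunc.adjoin_X]
        trivial
      induction hy using IntermediateField.adjoin_induction with
      | mem x hx => rw [hx, h1]
      | algebraMap c => exact AlgEquiv.commutes _ _
      | add x y _ _ hx hy => rw [map_add, hx, hy]
      | inv x _ hx => rw [map_inv₀, hx]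
      | mul x y _ _ hx hy => rw [map_mul, hx, hy]
    have h3 := hτ g (ε.symm ⟨m g, hmL g⟩)
    rw [h2, AlgEquiv.apply_symm_apply] at h3
    exact h3.symm
  · obtain ⟨a, b, c, d, h0, h⟩ := ratFunc_algEquiv_apply_X (τ g)
    refine ⟨a, b, c, d, h0, ?_⟩
    have h1 := congrArg (fun y => (ε y : F)) h
    simp only [map_mul, map_add, AlgEquiv.commutes, MulMemClass.coe_mul, IntermediateField.coe_add,
      hτ] at h1
    exact h1

/-! ### Lifting a Möbius action to a linear one -/

/-- Only the identity acts by a scalar matrix. -/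
def IsProjectivelyFaithful {K : Type u} [Field K] {G : Type w} [Group G]
    (M : G →* Matrix (Fin 2) (Fin 2) K) : Prop :=
  ∀ (g : G) (c : K), M g = c • 1 → g = 1

/-- A faithful Möbius action on a rational function lifts to the span of the numerator and the
denominator. -/
theorem exists_isProjectivelyFaithful_of_moebius {K : Type u} [Field K] {A : Type v} [CommRing A]
    [IsDomain A] [UniqueFactorizationMonoid A] [Algebra K A]
    (hunits : ∀ y : A, IsUnit y → ∃ c : K, algebraMap K A c = y)
    {F : Type w} [Field F] [Algebra K F] [Algebra A F]
    [IsScalarTower K A F] [IsFractionRing A F] {G : Type*} [Group G]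
    (γ : G →* (A ≃ₐ[K] A)) (δ : G →* (F ≃ₐ[K] F))
    (hγδ : ∀ g y, δ g (algebraMap A F y) = algebraMap A F (γ g y)) {x : F}
    (hx : ∀ c : K, algebraMap K F c ≠ x) (hfaith : ∀ g, δ g x = x → g = 1)
    (hact : ∀ g, ∃ a b c d : K, a * d - b * c ≠ 0 ∧
        δ g x * (algebraMap K _ c * x + algebraMap K _ d) =
          algebraMap K _ a * x + algebraMap K _ b) :
    ∃ M : G →* Matrix (Fin 2) (Fin 2) K, IsProjectivelyFaithful M := by
  obtain ⟨p, ⟨q, hq⟩, hrel, rfl⟩ := IsFractionRing.exists_reduced_fraction A x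
  set x := IsLocalization.mk' F p ⟨q, hq⟩ with hxdef
  have hq0 : q ≠ 0 := nonZeroDivisors.ne_zero hq
  have hinj := IsFractionRing.injective A F
  have hxq : x * algebraMap A F q = algebraMap A F p := IsLocalization.mk'_spec F p ⟨q, hq⟩
  replace hrel : IsRelPrime p q := hrel
  have hqF : algebraMap A F q ≠ 0 := fun h => hq0 (hinj (by rw [h, map_zero]))
  have hindep : ∀ s t : K, s • p + t • q = 0 → s = 0 ∧ t = 0 := fun s t h => by
    have h1 : algebraMap K F s * x + algebraMap K F t = 0 := by
      refine (mul_eq_zero.mp ?_).resolve_right hqF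
      have h2 := congrArg (algebraMap A F) h
      rw [map_add, Algebra.smul_def, Algebra.smul_def, map_mul, map_mul,
        ← IsScalarTower.algebraMap_apply, ← IsScalarTower.algebraMap_apply, map_zero, ← hxq] at h2
      linear_combination h2
    have hs : s = 0 := by
      by_contra hs
      have hs' : algebraMap K F s ≠ 0 := by simpa using hs
      refine hx (-t / s) ?_
      rw [map_div₀, map_neg, div_eq_iff hs']
      linear_combination -h1
    refine ⟨hs, ?_⟩
    rw [hs, map_zero, zero_mul, zero_add] at h1
    simpa using h1
  have hp0 : p ≠ 0 := fun h => by
    have := (hindep 1 0 (by simp [h])).1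
    exact one_ne_zero this
  have key : ∀ g, ∃ N : Matrix (Fin 2) (Fin 2) K,
      γ g p = N 0 0 • p + N 1 0 • q ∧ γ g q = N 0 1 • p + N 1 1 • q := fun g => by
    obtain ⟨a, b, c, d, hdet, h⟩ := hact g
    have hgx : δ g x * algebraMap A F (γ g q) = algebraMap A F (γ g p) := by
      rw [← hγδ, ← hγδ, ← map_mul, hxq]
    have hgrel : IsRelPrime (γ g p) (γ g q) := fun r h1 h2 => by
      have h3 := hrel (d := (γ g).symm r) (by simpa using map_dvd (γ g).symm h1)
        (by simpa using map_dvd (γ g).symm h2)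
      simpa using h3.map (γ g)
    have hdetU : IsUnit (algebraMap K A (a * d - b * c)) := (IsUnit.mk0 _ hdet).map _
    have hcomb : IsRelPrime (a • p + b • q) (c • p + d • q) := fun r h1 h2 => by
      have h3 : r ∣ algebraMap K A (a * d - b * c) * p := by
        have := dvd_sub (h1.mul_left (algebraMap K A d)) (h2.mul_left (algebraMap K A b))
        convert this using 1
        simp only [Algebra.smul_def, map_sub, map_mul]
        ring
      have h4 : r ∣ algebraMap K A (a * d - b * c) * q := by
        have := dvd_sub (h2.mul_left (algebraMap K A a)) (h1.mul_left (algebraMap K A c))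
        convert this using 1
        simp only [Algebra.smul_def, map_sub, map_mul]
        ring
      exact hrel (hdetU.dvd_mul_left.mp h3) (hdetU.dvd_mul_left.mp h4)
    have hcross : γ g p * (c • p + d • q) = γ g q * (a • p + b • q) := by
      apply hinj
      simp only [map_mul, map_add, Algebra.smul_def, ← IsScalarTower.algebraMap_apply, ← hgx, ← hxq]
      linear_combination algebraMap A F q * algebraMap A F (γ g q) * h
    -- Both γ g p / γ g q and (ap + bq)/(cp + dq) are reduced forms of the same fraction, so they
    -- differ by a unit, which is a constant.
    have hd1 : γ g p ∣ a • p + b • q := hgrel.dvd_of_dvd_mul_left ⟨_, hcross.symm⟩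
    have hd2 : a • p + b • q ∣ γ g p :=
      hcomb.dvd_of_dvd_mul_right ⟨γ g q, by rw [hcross, mul_comm]⟩
    obtain ⟨μ, hμ⟩ := associated_of_dvd_dvd hd2 hd1
    obtain ⟨l, hl⟩ := hunits μ μ.isUnit
    rw [← hl] at hμ
    have h0 : a • p + b • q ≠ 0 := fun h => by
      obtain ⟨rfl, rfl⟩ := hindep _ _ h
      simp at hdet
    have hμ' : γ g q = (c • p + d • q) * algebraMap K A l := by
      apply mul_left_cancel₀ h0
      rw [← mul_comm (γ g q), ← hcross, ← hμ]
      ring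
    -- The coefficients are transposed: columns hold the images of p and q, which makes N
    -- multiplicative.
    refine ⟨!![l * a, l * c; l * b, l * d], ?_, ?_⟩
    · rw [← hμ]
      simp [Algebra.smul_def]
      ring
    · rw [hμ']
      simp [Algebra.smul_def]
      ring
  choose N hNp hNq using key
  have hindep' : ∀ s t s' t' : K, s • p + t • q = s' • p + t' • q → s = s' ∧ t = t' :=
    fun s t s' t' h => by
      have := hindep (s - s') (t - t') (by rw [sub_smul, sub_smul]; linear_combination h)
      exact ⟨sub_eq_zero.mp this.1, sub_eq_zero.mp this.2⟩
  have hN1 : N 1 = 1 := by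
    have h1 := hindep' _ _ 1 0 ((hNp 1).symm.trans (by simp))
    have h2 := hindep' _ _ 0 1 ((hNq 1).symm.trans (by simp))
    ext i j
    fin_cases i <;> fin_cases j <;> simp [h1, h2]
  have hNmul : ∀ g g', N (g * g') = N g * N g' := fun g g' => by
    have h1 := hindep' _ _ (N g 0 0 * N g' 0 0 + N g 0 1 * N g' 1 0)
      (N g 1 0 * N g' 0 0 + N g 1 1 * N g' 1 0) ((hNp (g * g')).symm.trans (by
        rw [map_mul, AlgEquiv.mul_apply, hNp, map_add, map_smul, map_smul, hNp, hNq]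
        simp only [Algebra.smul_def, map_add, map_mul]
        ring))
    have h2 := hindep' _ _ (N g 0 0 * N g' 0 1 + N g 0 1 * N g' 1 1)
      (N g 1 0 * N g' 0 1 + N g 1 1 * N g' 1 1) ((hNq (g * g')).symm.trans (by
        rw [map_mul, AlgEquiv.mul_apply, hNq, map_add, map_smul, map_smul, hNp, hNq]
        simp only [Algebra.smul_def, map_add, map_mul]
        ring))
    ext i j
    fin_cases i <;> fin_cases j <;> simp [Matrix.mul_apply, h1, h2]
  refine ⟨⟨⟨N, hN1⟩, hNmul⟩, fun g c hc => hfaith g ?_⟩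
  replace hc : N g = c • 1 := hc
  have hgp : γ g p = c • p := by rw [hNp, hc]; simp
  have hgq : γ g q = c • q := by rw [hNq, hc]; simp
  have h1 : δ g x * algebraMap A F (γ g q) = algebraMap A F (γ g p) := by
    rw [← hγδ, ← hγδ, ← map_mul, hxq]
  have h2 : algebraMap A F (γ g q) ≠ 0 := fun h =>
    hq0 ((γ g).injective (hinj (by rw [h, map_zero, map_zero])))
  apply mul_right_cancel₀ h2
  rw [h1, hgp, hgq]
  simp only [Algebra.smul_def, map_mul]
  rw [← hxq]
  ring

/-! ### Realizing a representation by rational functions -/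

/-- A finite group of field automorphisms has an element with linearly independent conjugates. -/
theorem exists_linearIndependent_conjugates {K : Type u} [Field K] {F : Type v} [Field F]
    [Algebra K F] {G : Type w} [Group G] [Fintype G] (δ : G →* (F ≃ₐ[K] F))
    (hδ : Function.Injective δ) :
    ∃ y : F, ∀ c : G → K, ∑ g, algebraMap K F (c g) * δ g y = 0 → ∀ g, c g = 0 := by
  classical
  let _ : MulSemiringAction G F := MulSemiringAction.compHom F δ
  have hsmul : ∀ (g : G) (x : F), g • x = δ g x := fun _ _ => rfl
  have : FaithfulSMul G F := ⟨fun {g h} hgh => hδ (AlgEquiv.ext hgh)⟩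
  -- A normal basis of F over the fixed field is independent over that field, hence over K, which
  -- embeds in it.
  let k := FixedPoints.subfield G F
  let b := IsGalois.normalBasis k F
  let ψ : G ≃* Gal(F/k) := FixedPoints.toAlgAutMulEquiv G F
  refine ⟨b 1, fun c hc g => ?_⟩
  let c' : G → k := fun g => ⟨algebraMap K F (c g), fun h => by rw [hsmul, AlgEquiv.commutes]⟩
  have hli := Fintype.linearIndependent_iff.mp b.linearIndependent (fun σ => c' (ψ.symm σ)) (by
    rw [← hc, ← Equiv.sum_comp ψ.toEquiv]
    refine Finset.sum_congr rfl fun g _ => ?_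
    rw [IsGalois.normalBasis_apply]
    simp only [MulEquiv.toEquiv_eq_coe, MulEquiv.coe_toEquiv, MulEquiv.symm_apply_apply]
    rfl) (ψ g)
  rw [MulEquiv.symm_apply_apply] at hli
  have h1 : algebraMap K F (c g) = 0 := congrArg Subtype.val hli
  simpa using h1

theorem trdeg_adjoin_simple {K : Type u} [Field K] {F : Type v} [Field F] [Algebra K F] {x : F}
    (hx : Transcendental K x) : Algebra.trdeg K (IntermediateField.adjoin K {x}) = 1 := by
  have h1 := (RatFunc.algEquivOfTranscendental x hx).lift_trdeg_eq
  have h2 : Algebra.trdeg K (RatFunc K) = 1 := by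
    have : Algebra.IsAlgebraic K[X] (RatFunc K) :=
      IsLocalization.isAlgebraic (R := K[X]) (S := RatFunc K) (nonZeroDivisors K[X])
    rw [← trdeg_add_eq K K[X] (A := RatFunc K), trdeg_eq_zero (R := K[X]),
      Polynomial.trdeg_of_isDomain, add_zero]
  rw [h2, Cardinal.lift_one] at h1
  exact Cardinal.lift_eq_one.mp h1.symm

/-- A row vector that is not an eigenvector of a given non-scalar matrix. -/
theorem exists_vecMul_ne {K : Type u} [Field K] {N : Matrix (Fin 2) (Fin 2) K}
    (hN : ∀ c : K, N ≠ c • 1) :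
    ∃ l : Fin 2 → K, ∀ v : Fin 2 → K, l ⬝ᵥ v = 0 → Matrix.vecMul l N ⬝ᵥ v = 0 → v = 0 := by
  have main : ∃ l : Fin 2 → K, l 0 * Matrix.vecMul l N 1 - l 1 * Matrix.vecMul l N 0 ≠ 0 := by
    by_contra! h
    -- The two basis vectors kill the off-diagonal entries of N; their sum equates the diagonal
    -- ones.
    have h1 := h ![1, 0]
    have h2 := h ![0, 1]
    have h3 := h ![1, 1]
    simp [Matrix.vecMul, dotProduct] at h1 h2 h3
    refine hN (N 0 0) ?_
    ext i j
    fin_cases i <;> fin_cases j <;> simp [h1, h2]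
    rw [h1, h2] at h3
    linear_combination h3
  obtain ⟨l, hl⟩ := main
  refine ⟨l, fun v h1 h2 => ?_⟩
  rw [dotProduct, Fin.sum_univ_two] at h1 h2
  ext i
  fin_cases i
  · refine (mul_eq_zero.mp (?_ : _ * v 0 = 0)).resolve_left hl
    linear_combination Matrix.vecMul l N 1 * h1 - l 1 * h2
  · refine (mul_eq_zero.mp (?_ : _ * v 1 = 0)).resolve_left hl
    linear_combination l 0 * h2 - Matrix.vecMul l N 0 * h1

/-- A projectively faithful representation of degree two is realized by rational functions. -/
theorem exists_adjoin_stable_faithful {K : Type u} [Field K] {F : Type v} [Field F] [Algebra K F]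
    (hK : ∀ x : F, IsAlgebraic K x → ∃ c : K, algebraMap K F c = x)
    {G : Type w} [Group G] [Finite G] [Nontrivial G] (δ : G →* (F ≃ₐ[K] F))
    (hδ : Function.Injective δ) {M : G →* Matrix (Fin 2) (Fin 2) K}
    (hM : IsProjectivelyFaithful M) :
    ∃ x : F, Transcendental K x ∧
      (∀ g, δ g x ∈ IntermediateField.adjoin K {x}) ∧ ∀ g, δ g x = x → g = 1 := by
  have := Fintype.ofFinite G
  obtain ⟨y, hy⟩ := exists_linearIndependent_conjugates δ hδ
  obtain ⟨g₀, hg₀⟩ := exists_ne (1 : G)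
  obtain ⟨l, hl⟩ := exists_vecMul_ne (N := M g₀) fun c hc => hg₀ (hM _ c hc)
  -- The twist by M(g⁻¹) makes the row (u 0, u 1) transform under k by right multiplication with
  -- M(k).
  let u : Fin 2 → F := fun i => ∑ g, algebraMap K F (Matrix.vecMul l (M g⁻¹) i) * δ g y
  have hu : ∀ v : Fin 2 → K, u 0 * algebraMap K F (v 0) + u 1 * algebraMap K F (v 1) = 0 →
      v = 0 := fun v hv => by
    have h1 := hy (fun g => Matrix.vecMul l (M g⁻¹) ⬝ᵥ v) (by
      rw [← hv, Finset.sum_mul, Finset.sum_mul, ← Finset.sum_add_distrib]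
      refine Finset.sum_congr rfl fun g _ => ?_
      rw [dotProduct, Fin.sum_univ_two, map_add, map_mul, map_mul]
      ring)
    -- Independence gives a relation for every g; those at 1 and g₀⁻¹ say that l and l M(g₀) both
    -- annihilate v.
    refine hl v ?_ ?_
    · simpa using h1 1
    · simpa using h1 g₀⁻¹
  have hact : ∀ k i, δ k (u i) = u 0 * algebraMap K F (M k 0 i) + u 1 * algebraMap K F (M k 1 i) :=
    fun k i => by
      have hsum : u 0 * algebraMap K F (M k 0 i) + u 1 * algebraMap K F (M k 1 i) =
          ∑ g, algebraMap K F (Matrix.vecMul l (M g⁻¹ * M k) i) * δ g y := by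
        simp only [u]
        rw [Finset.sum_mul, Finset.sum_mul, ← Finset.sum_add_distrib]
        refine Finset.sum_congr rfl fun g _ => ?_
        rw [← Matrix.vecMul_vecMul]
        nth_rewrite 3 [Matrix.vecMul]
        rw [dotProduct, Fin.sum_univ_two, map_add, map_mul, map_mul]
        ring
      rw [hsum, map_sum]
      refine Fintype.sum_equiv (Equiv.mulLeft k) _ _ fun g => ?_
      rw [map_mul, AlgEquiv.commutes, ← AlgEquiv.mul_apply, ← map_mul, Equiv.coe_mulLeft,
        ← map_mul M, mul_inv_rev, inv_mul_cancel_right]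
  have hu1 : u 1 ≠ 0 := fun h => by
    have := congrFun (hu ![0, 1] (by simp [h])) 1
    simp at this
  have hx : Transcendental K (u 0 / u 1) := fun h => by
    obtain ⟨c, hc⟩ := hK _ h
    rw [eq_div_iff hu1] at hc
    have := congrFun (hu ![1, -c] (by simp [← hc, mul_comm])) 0
    simp at this
  have hδx : ∀ g, δ g (u 0 / u 1) =
      (u 0 / u 1 * algebraMap K F (M g 0 0) + algebraMap K F (M g 1 0)) /
        (u 0 / u 1 * algebraMap K F (M g 0 1) + algebraMap K F (M g 1 1)) := fun g => by
    rw [map_div₀, hact, hact, ← mul_div_mul_right _ (_ / _ * _ + _) hu1]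
    congr 1 <;> field_simp
  refine ⟨u 0 / u 1, hx, fun g => ?_, fun g hg => ?_⟩
  · rw [hδx]
    have h1 := IntermediateField.mem_adjoin_simple_self K (u 0 / u 1)
    have h2 := fun c : K => (IntermediateField.adjoin K {u 0 / u 1}).algebraMap_mem c
    exact div_mem (add_mem (mul_mem h1 (h2 _)) (h2 _)) (add_mem (mul_mem h1 (h2 _)) (h2 _))
  · have hden : δ g (u 1) ≠ 0 := by simpa using hu1
    rw [map_div₀, div_eq_div_iff hden hu1, hact, hact] at hg
    -- Fixing x is a quadratic equation for x over K; as x is transcendental its coefficients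
    -- vanish, which says that M g is scalar.
    have hq : aeval (u 0 / u 1) (C (M g 0 1) * X ^ 2 + C (M g 1 1 - M g 0 0) * X
        - C (M g 1 0)) = 0 := by
      simp only [map_sub, map_add, map_mul, map_pow, aeval_X, aeval_C]
      field_simp
      linear_combination -hg
    have hq0 := transcendental_iff.mp hx _ hq
    have c0 := congrArg (fun q => coeff q 0) hq0
    have c1 := congrArg (fun q => coeff q 1) hq0
    have c2 := congrArg (fun q => coeff q 2) hq0
    simp [coeff_X, coeff_C] at c0 c1 c2
    refine hM g (M g 0 0) ?_
    ext i j
    fin_cases i <;> fin_cases j <;> simp [c0, c2, sub_eq_zero.mp c1]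

end

/-! ### The criterion for essential dimension one -/

theorem fieldAut_algebraMap {K : Type u} [Field K] {G : Type w} [Group G]
    {V : Type v} [AddCommGroup V] [Module K V] (ρ : Representation K G V) (g : G)
    (y : CoordinateRing K V) :
    fieldAut ρ g (algebraMap (CoordinateRing K V) (FunctionField K V) y) =
      algebraMap (CoordinateRing K V) (FunctionField K V) (coordAut ρ g y) :=
  IsFractionRing.fieldEquivOfAlgEquiv_algebraMap K _ _ (coordAut ρ g) _

/-- A nontrivial finite group has essential dimension one if and only if it has a projectively
faithful representation of degree two. -/
theorem ed_eq_one_iff {K : Type u} [Field K] {G : Type w} [Group G] [Finite G] [Nontrivial G]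
    {V : Type v} [AddCommGroup V] [Module K V] [FiniteDimensional K V]
    (ρ : Representation K G V) (hρ : Function.Injective ρ) :
    ed ρ = 1 ↔ ∃ M : G →* Matrix (Fin 2) (Fin 2) K, IsProjectivelyFaithful M := by
  have e := SymmetricAlgebra.equivMvPolynomial (Module.finBasis K (Module.Dual K V))
  have : UniqueFactorizationMonoid (CoordinateRing K V) :=
    e.symm.toMulEquiv.uniqueFactorizationMonoid inferInstance
  have hconst : ∀ x : FunctionField K V, IsAlgebraic K x → ∃ c : K, algebraMap K _ c = x :=
    fun x hx => mem_range_of_isAlgebraic e hx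
  have hunits : ∀ y : CoordinateRing K V, IsUnit y → ∃ c : K, algebraMap K _ c = y :=
    fun y hy => by
      obtain ⟨c, -, hc⟩ := MvPolynomial.isUnit_iff_eq_C_of_isReduced.mp (hy.map e)
      exact ⟨c, e.injective (by rw [hc, AlgEquiv.commutes]; rfl)⟩
  constructor
  · intro h
    have hmem : (1 : Cardinal.{max u v}) ∈ {d | ∃ E : IntermediateField K (FunctionField K V),
        IsFaithfulGSubfield ρ E ∧ d = Algebra.trdeg K E} := by
      rw [← h]
      exact csInf_mem ⟨_, ⊤, isFaithfulGSubfield_top ρ hρ, rfl⟩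
    obtain ⟨E, hE, hd⟩ := hmem
    obtain ⟨x, hx, hfaith, hact⟩ :=
      exists_moebius_action e (fieldAut ρ) hd.ge hE.stable hE.faithful
    exact exists_isProjectivelyFaithful_of_moebius hunits (coordAut ρ) (fieldAut ρ)
      (fieldAut_algebraMap ρ) hx hfaith hact
  · rintro ⟨M, hM⟩
    have hinj : Function.Injective (fieldAut ρ) :=
      (injective_iff_map_eq_one _).mpr fun g hg =>
        (isFaithfulGSubfield_top ρ hρ).faithful g fun x _ => by rw [hg, AlgEquiv.one_apply]
    obtain ⟨x, hx, hstab, hfaith⟩ := exists_adjoin_stable_faithful hconst (fieldAut ρ) hinj hM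
    have hE : IsFaithfulGSubfield ρ (IntermediateField.adjoin K {x}) := by
      refine ⟨fun g y hy => ?_, fun g hg => hfaith g (hg x (IntermediateField.subset_adjoin K _ rfl))⟩
      have h1 : IntermediateField.adjoin K {x} ≤
          (IntermediateField.adjoin K {x}).comap (fieldAut ρ g).toAlgHom :=
        IntermediateField.adjoin_simple_le_iff.mpr (hstab g)
      exact h1 hy
    refine le_antisymm (csInf_le' ⟨_, hE, (trdeg_adjoin_simple hx).symm⟩) ?_
    refine le_csInf ⟨_, _, hE, rfl⟩ ?_
    rintro _ ⟨E, hE, rfl⟩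
    -- In transcendence degree zero every element of E is constant, so all of G would act trivially.
    rw [Cardinal.one_le_iff_ne_zero, Ne, trdeg_eq_zero_iff]
    intro halg
    obtain ⟨g, hg⟩ := exists_ne (1 : G)
    refine hg (hE.faithful g fun y hy => ?_)
    obtain ⟨c, rfl⟩ := hconst y ((halg.isAlgebraic ⟨y, hy⟩).algHom E.val)
    exact AlgEquiv.commutes _ _

/-! ### Necessary conditions for dihedral groups -/

section

open DihedralGroup

/-- The commutant of a non-scalar matrix of size two. -/
theorem exists_eq_smul_add_smul_of_commute {K : Type u} [Field K] {A B : Matrix (Fin 2) (Fin 2) K}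
    (hA : ∀ c : K, A ≠ c • 1) (h : A * B = B * A) : ∃ x y : K, B = x • 1 + y • A := by
  have e := fun i j => congrFun (congrFun h i) j
  simp only [Matrix.mul_apply, Fin.sum_univ_two] at e
  have e00 := e 0 0
  have e01 := e 0 1
  have e10 := e 1 0
  -- Modulo scalars a matrix is the vector of its off-diagonal entries and its diagonal difference.
  -- The entries of AB − BA are, up to sign and multiplicity, the minors of the two vectors, so
  -- commuting means proportional.
  suffices ∃ y, B 0 1 = y * A 0 1 ∧ B 1 0 = y * A 1 0 ∧ B 0 0 - B 1 1 = y * (A 0 0 - A 1 1) by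
    obtain ⟨y, h1, h2, h3⟩ := this
    refine ⟨B 0 0 - y * A 0 0, y, ?_⟩
    ext i j
    fin_cases i <;> fin_cases j <;> simp [h1, h2]
    linear_combination -h3
  by_cases hb : A 0 1 = 0
  · by_cases hc : A 1 0 = 0
    · have hd : A 0 0 - A 1 1 ≠ 0 := fun hd => hA (A 0 0) (by
        ext i j
        fin_cases i <;> fin_cases j <;> simp [hb, hc, (sub_eq_zero.mp hd)])
      have h1 : B 0 1 = 0 := by
        refine (mul_eq_zero.mp ?_).resolve_left hd
        rw [hb] at e01
        linear_combination e01
      have h2 : B 1 0 = 0 := by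
        refine (mul_eq_zero.mp ?_).resolve_left hd
        rw [hc] at e10
        linear_combination -e10
      exact ⟨(B 0 0 - B 1 1) / (A 0 0 - A 1 1), by rw [h1, hb, mul_zero], by rw [h2, hc, mul_zero],
        (div_mul_cancel₀ _ hd).symm⟩
    · refine ⟨B 1 0 / A 1 0, ?_, ?_, ?_⟩
      · field_simp
        linear_combination -e00
      · field_simp
      · field_simp
        linear_combination e10
  · refine ⟨B 0 1 / A 0 1, ?_, ?_, ?_⟩
    · field_simp
    · field_simp
      linear_combination e00
    · field_simp
      linear_combination -e01

namespace IsProjectivelyFaithful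

variable {K : Type u} [Field K] {n : ℕ} {M : DihedralGroup n →* Matrix (Fin 2) (Fin 2) K}

theorem r_ne_smul_one (hM : IsProjectivelyFaithful M) {k : ℕ} (hk : ¬ n ∣ k) (c : K) :
    M (r k) ≠ c • 1 := fun h => by
  have := hM _ c h
  rw [one_def, r.injEq, ZMod.natCast_eq_zero_iff] at this
  exact hk this

theorem sr_ne_smul_one (hM : IsProjectivelyFaithful M) (i : ZMod n) (c : K) :
    M (sr i) ≠ c • 1 := fun h => by
  have := hM _ c h
  rw [one_def] at this
  exact nomatch this

/-- The central involution and a reflection, in degree two. -/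
theorem exists_sr_eq (hM : IsProjectivelyFaithful M) {m : ℕ} (hm : n = 2 * m) (hn : 0 < n) :
    (∀ c : K, M (r m) ≠ c • 1) ∧ M (r m) * M (r m) = 1 ∧
      ∃ x y : K, M (sr 0) = x • 1 + y • M (r m) ∧
        (2 * x * y) • M (r m) = (1 - x ^ 2 - y ^ 2) • 1 := by
  have h1 : ∀ c : K, M (r m) ≠ c • 1 := hM.r_ne_smul_one fun h => by
    have := Nat.le_of_dvd (by omega) h
    omega
  have h2 : (m : ZMod n) + m = 0 := by
    rw [← Nat.cast_add, ZMod.natCast_eq_zero_iff, hm, two_mul]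
  have hzz : M (r m) * M (r m) = 1 := by rw [← map_mul, r_mul_r, h2, r_zero, map_one]
  have hss : M (sr 0) * M (sr 0) = 1 := by rw [← map_mul, sr_mul_self, map_one]
  obtain ⟨x, y, hs⟩ := exists_eq_smul_add_smul_of_commute (B := M (sr 0)) h1 (by
    rw [← map_mul, ← map_mul, r_mul_sr, sr_mul_r, zero_sub, zero_add,
      neg_eq_of_add_eq_zero_left h2])
  refine ⟨h1, hzz, x, y, hs, ?_⟩
  rw [hs] at hss
  simp only [add_mul, mul_add, smul_mul_assoc, mul_smul_comm, hzz, one_mul, mul_one] at hss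
  have h3 : (x ^ 2 + y ^ 2) • 1 + (2 * x * y) • M (r m) = 1 := by
    refine Eq.trans ?_ hss
    module
  rw [← eq_sub_iff_add_eq'] at h3
  rw [h3]
  module

/-- For even n, let z be the central involution. A reflection is x + yz, and its square being 1
forces 2xy = 0 since z is not scalar. So the reflection or its product with z is scalar. -/
theorem odd_of_two_ne_zero (hM : IsProjectivelyFaithful M) (hn : 0 < n) (h2 : (2 : K) ≠ 0) :
    Odd n := by
  by_contra hodd
  obtain ⟨m, hm⟩ := (Nat.not_odd_iff_even.mp hodd).two_dvd
  obtain ⟨hz, hzz, x, y, hs, h3⟩ := hM.exists_sr_eq hm hn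
  by_cases hxy : 2 * x * y = 0
  · rcases mul_eq_zero.mp hxy with h | h
    · have hx := (mul_eq_zero.mp h).resolve_left h2
      rw [hx, zero_smul, zero_add] at hs
      refine hM.sr_ne_smul_one (0 + m) y ?_
      rw [← sr_mul_r, map_mul, hs, smul_mul_assoc, hzz]
    · rw [h, zero_smul, add_zero] at hs
      exact hM.sr_ne_smul_one 0 x hs
  · refine hz ((2 * x * y)⁻¹ * (1 - x ^ 2 - y ^ 2)) ?_
    rw [← smul_smul, ← h3, smul_smul, inv_mul_cancel₀ hxy, one_smul]

/-- Writing a reflection as x + yz, the relation on its square becomes x + y = 1. Faithfulness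
excludes x = 0 and x = 1, so 0, 1, x, 1 + x are distinct. -/
theorem four_le_mk [CharP K 2] {M : DihedralGroup 2 →* Matrix (Fin 2) (Fin 2) K}
    (hM : IsProjectivelyFaithful M) : 4 ≤ Cardinal.mk K := by
  obtain ⟨-, hzz, x, y, hs, h3⟩ := hM.exists_sr_eq (m := 1) rfl two_pos
  have h2 : (2 : K) = 0 := CharTwo.two_eq_zero
  have hxy : x + y = 1 := by
    have h4 := congrFun (congrFun h3 0) 0
    simp [h2] at h4
    refine sub_eq_zero.mp (pow_eq_zero_iff two_ne_zero |>.mp ?_)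
    linear_combination h4 + (x * y - x - y + 1) * h2
  have hx0 : x ≠ 0 := by
    rintro rfl
    rw [zero_add] at hxy
    rw [hxy, zero_smul, zero_add, one_smul] at hs
    refine hM.sr_ne_smul_one (0 + (1 : ℕ)) 1 ?_
    rw [← sr_mul_r, map_mul, hs, hzz, one_smul]
  have hx1 : x ≠ 1 := by
    rintro rfl
    rw [add_eq_left.mp hxy, zero_smul, add_zero] at hs
    exact hM.sr_ne_smul_one 0 1 hs
  have hx1' : 1 + x ≠ 0 := fun h => hx1 (by linear_combination h - h2)
  have hinj : Function.Injective ![0, 1, x, 1 + x] := by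
    clear h2 h3 hs hzz hxy
    have h10 : (1 : K) ≠ 0 := one_ne_zero
    intro i j hij
    fin_cases i <;> fin_cases j <;> simp_all [eq_comm]
  have := Cardinal.lift_mk_le_lift_mk_of_injective hinj
  simpa using this

/-- The generating rotation commutes with u, the rotation of order p, so it is x + yu. Its p-th
power is x^p + y^p by Frobenius and u^p = 1, a scalar; hence n divides p. The case p = 2 is
included. -/
theorem eq_char_of_dvd (hM : IsProjectivelyFaithful M) (hn : 0 < n) {p : ℕ} (hp : p.Prime)
    [CharP K p] (hpn : p ∣ n) : n = p := by
  obtain ⟨m, hm⟩ := hpn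
  have h1 : ∀ c : K, M (r m) ≠ c • 1 := hM.r_ne_smul_one fun h => by
    have hm0 : 0 < m := Nat.pos_of_ne_zero fun h => by simp [h] at hm; omega
    have := Nat.le_of_dvd hm0 h
    nlinarith [hp.two_le]
  have h2 : M (r m) ^ p = 1 := by
    rw [← map_pow, r_pow, ← Nat.cast_mul, mul_comm, ← hm, ZMod.natCast_self, r_zero, map_one]
  obtain ⟨x, y, hxy⟩ := exists_eq_smul_add_smul_of_commute (B := M (r (1 : ℕ))) h1 (by
    rw [← map_mul, ← map_mul, r_mul_r, r_mul_r, add_comm])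
  have : Fact p.Prime := ⟨hp⟩
  have h3 : M (r p) = (x ^ p + y ^ p) • 1 := by
    have h4 : (M (r (1 : ℕ))) ^ p = M (r p) := by
      rw [← map_pow, r_pow, Nat.cast_one, one_mul]
    have hcomm : Commute (x • (1 : Matrix (Fin 2) (Fin 2) K)) (y • M (r m)) :=
      ((Commute.one_left _).smul_left x).smul_right y
    rw [← h4, hxy, add_pow_char_of_commute _ hcomm, smul_pow, smul_pow, h2, one_pow, add_smul]
  by_contra hne
  refine hM.r_ne_smul_one (fun h => hne ?_) _ h3
  exact Nat.dvd_antisymm h ⟨m, hm⟩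

/-- The rotation R is conjugate to its inverse and has odd order, so det R = 1 and an eigenvalue ζ
satisfies ζ + ζ⁻¹ = tr R. It is primitive because a power of R with eigenvalue 1 is unipotent, and n
being nonzero in K makes it trivial. -/
theorem zetaAddInvMem (hM : IsProjectivelyFaithful M) (hodd : Odd n) (hnK : (n : K) ≠ 0) :
    ZetaAddInvMem K n := by
  set R := M (r 1) with hR
  have hRpow : ∀ k : ℕ, R ^ k = M (r k) := fun k => by rw [hR, ← map_pow, r_one_pow]
  have hRn : R ^ n = 1 := by rw [hRpow, ZMod.natCast_self, r_zero, map_one]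
  have hdet : R.det = 1 := by
    have h1 : R * M (sr 0) * R = M (sr 0) := by
      rw [hR, ← map_mul, ← map_mul, r_mul_sr, sr_mul_r, zero_sub, neg_add_cancel]
    have h2 : M (sr 0) * M (sr 0) = 1 := by rw [← map_mul, sr_mul_self, map_one]
    have h3 := congrArg Matrix.det h1
    have h4 := congrArg Matrix.det h2
    rw [Matrix.det_mul, Matrix.det_mul] at h3
    rw [Matrix.det_mul, Matrix.det_one] at h4
    have h5 : R.det ^ 2 = 1 := by
      linear_combination (M (sr 0)).det * h3 + (1 - R.det ^ 2) * h4
    have h6 : R.det ^ n = 1 := by rw [← Matrix.det_pow, hRn, Matrix.det_one]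
    obtain ⟨k, rfl⟩ := hodd
    rwa [pow_succ, pow_mul, h5, one_pow, one_mul] at h6
  let Kb := AlgebraicClosure K
  let f := algebraMap K Kb
  obtain ⟨ζ, hζ⟩ := IsAlgClosed.exists_root (R.map f).charpoly (by
    rw [Matrix.charpoly_degree_eq_dim]; simp)
  have hroot : (Matrix.scalar (Fin 2) ζ - R.map f).det = 0 := by
    rw [← Matrix.eval_charpoly]; exact hζ
  obtain ⟨v, hv0, hv⟩ := Matrix.exists_mulVec_eq_zero_iff.mpr hroot
  have hRv : (R.map f).mulVec v = ζ • v := by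
    rw [Matrix.sub_mulVec, sub_eq_zero] at hv
    rw [← hv]
    simp [← Matrix.smul_one_eq_diagonal, Matrix.smul_mulVec]
  have hRkv : ∀ k : ℕ, ((R ^ k).map f).mulVec v = ζ ^ k • v := fun k => by
    induction k with
    | zero => simp
    | succ k ih => rw [pow_succ, Matrix.map_mul, ← Matrix.mulVec_mulVec, hRv, Matrix.mulVec_smul, ih,
        smul_smul, pow_succ, mul_comm]
  have hdetb : f R.det = 1 := by rw [hdet, map_one]
  have hquad : ζ * ζ - f (R 0 0 + R 1 1) * ζ + 1 = 0 := by
    rw [Matrix.det_fin_two] at hroot hdetb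
    simp at hroot hdetb
    rw [map_add]
    linear_combination hroot - hdetb
  have hζ0 : ζ ≠ 0 := by
    rintro rfl
    simp at hquad
  refine ⟨ζ, ⟨?_, fun k hk => ?_⟩, R 0 0 + R 1 1, ?_⟩
  · have h1 := hRkv n
    rw [hRn, Matrix.map_one _ (map_zero f) (map_one f), Matrix.one_mulVec] at h1
    have h2 : (ζ ^ n - 1) • v = 0 := by rw [sub_smul, ← h1, one_smul, sub_self]
    exact sub_eq_zero.mp ((smul_eq_zero.mp h2).resolve_right hv0)
  · have h1 : ((R ^ k - 1).map f).det = 0 := by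
      refine Matrix.exists_mulVec_eq_zero_iff.mp ⟨v, hv0, ?_⟩
      rw [Matrix.map_sub _ (map_sub f), Matrix.sub_mulVec, hRkv, hk,
        Matrix.map_one _ (map_zero f) (map_one f), Matrix.one_mulVec, one_smul, sub_self]
    have h2 : (R ^ k - 1).det = 0 := by
      have h3 : f (R ^ k - 1).det = 0 := by rw [RingHom.map_det]; exact h1
      exact (map_eq_zero f).mp h3
    have h3 : (R ^ k).det = 1 := by rw [Matrix.det_pow, hdet, one_pow]
    set N := R ^ k - 1 with hN
    have hRk : R ^ k = 1 + N := by rw [hN, add_sub_cancel]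
    rw [hRk] at h3
    -- From det N = 0 and det (1 + N) = 1 the trace of N vanishes, so N² = 0 by Cayley–Hamilton.
    have hNN : N * N = 0 := by
      rw [Matrix.det_fin_two] at h2 h3
      simp at h3
      have htr : N 0 0 + N 1 1 = 0 := by linear_combination h3 - h2
      ext i j
      fin_cases i <;> fin_cases j <;> simp [Matrix.mul_apply]
      · linear_combination N 0 0 * htr - h2
      · linear_combination N 0 1 * htr
      · linear_combination N 1 0 * htr
      · linear_combination N 1 1 * htr - h2
    have hpow : ∀ j : ℕ, (1 + N) ^ j = 1 + (j : K) • N := fun j => by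
      induction j with
      | zero => simp
      | succ j ih =>
        rw [pow_succ, ih, add_mul, mul_add, one_mul, one_mul, mul_add, mul_one, smul_mul_assoc, hNN,
          smul_zero, add_zero, Nat.cast_succ, add_smul, one_smul]
        abel
    have h4 := hpow n
    rw [← hRk, ← pow_mul, mul_comm, pow_mul, hRn, one_pow, left_eq_add] at h4
    have hN0 := (smul_eq_zero.mp h4).resolve_left hnK
    rw [hN0, add_zero, hRpow] at hRk
    by_contra hnk
    exact hM.r_ne_smul_one hnk 1 (by rw [hRk, one_smul])
  · change f _ = _
    rw [← mul_left_inj' hζ0, add_mul, inv_mul_cancel₀ hζ0]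
    linear_combination -hquad

end IsProjectivelyFaithful

/-! ### Construction of projectively faithful representations -/

/-- The presentation of the dihedral group. -/
theorem exists_dihedral_hom {H : Type w} [Group H] {n : ℕ} {a b : H} (ha : a ^ n = 1)
    (hb : b * b = 1) (hab : a * b * a = b) :
    ∃ M : DihedralGroup n →* H, M (r 1) = a ∧ M (sr 0) = b := by
  let φ : ZMod n →+ Additive H := ZMod.lift n ⟨zmultiplesHom (Additive H) (Additive.ofMul a), by
    rw [zmultiplesHom_apply, natCast_zsmul, ← ofMul_pow, ha, ofMul_one]⟩
  let ψ : ZMod n → H := fun i => (φ i).toMul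
  have hψadd : ∀ i j, ψ (i + j) = ψ i * ψ j := fun i j => by simp only [ψ, map_add, toMul_add]
  have hψint : ∀ k : ℤ, ψ k = a ^ k := fun k => by
    simp only [ψ, φ, ZMod.lift_coe, zmultiplesHom_apply, toMul_zsmul, toMul_ofMul]
  have hψ0 : ψ 0 = 1 := by simp only [ψ, map_zero, toMul_zero]
  have hbinv : b⁻¹ = b := inv_eq_of_mul_eq_one_left hb
  have hconj : ∀ i, ψ i * b = b * ψ (-i) := fun i => by
    obtain ⟨k, rfl⟩ := ZMod.intCast_surjective i
    rw [← Int.cast_neg, hψint, hψint, zpow_neg, ← inv_zpow]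
    have h1 : a * b = b * a⁻¹ := by rw [eq_mul_inv_iff_mul_eq, hab]
    exact (SemiconjBy.zpow_right (show SemiconjBy b a⁻¹ a from h1.symm) k).symm
  let f : DihedralGroup n → H
    | r i => ψ i
    | sr i => b * ψ i
  refine ⟨⟨⟨f, hψ0⟩, ?_⟩, ?_, ?_⟩
  · rintro (i | i) (j | j)
    · exact hψadd i j
    · change b * ψ (j - i) = ψ i * (b * ψ j)
      rw [← mul_assoc, hconj, mul_assoc, ← hψadd, sub_eq_neg_add]
    · change b * ψ (i + j) = b * ψ i * ψ j
      rw [hψadd, mul_assoc]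
    · change ψ (j - i) = b * ψ i * (b * ψ j)
      rw [mul_assoc, ← mul_assoc (ψ i), hconj, mul_assoc, ← mul_assoc, hb, one_mul, ← hψadd,
        sub_eq_neg_add]
  · change ψ 1 = a
    have := hψint 1
    rwa [Int.cast_one, zpow_one] at this
  · change b * ψ 0 = b
    rw [hψ0, mul_one]

theorem exists_dihedral_hom_matrix {K : Type u} [Field K] {n : ℕ} {A B : Matrix (Fin 2) (Fin 2) K}
    (hn : 0 < n) (hA : A ^ n = 1) (hB : B * B = 1) (hAB : A * B * A = B) :
    ∃ M : DihedralGroup n →* Matrix (Fin 2) (Fin 2) K, M (r 1) = A ∧ M (sr 0) = B := by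
  obtain ⟨M, h1, h2⟩ := exists_dihedral_hom (n := n) (a := Units.ofPowEqOne A n hA hn.ne')
    (b := ⟨B, B, hB, hB⟩) (Units.ext (by simp)) (Units.ext hB) (Units.ext hAB)
  exact ⟨(Units.coeHom _).comp M, congrArg Units.val h1, congrArg Units.val h2⟩

/-- A scalar reflection would commute with r 1, making r 2 act trivially; for odd n this leaves n =
1, where `sr 0` is the only reflection. -/
theorem isProjectivelyFaithful_of_odd {K : Type u} [Field K] {n : ℕ} (hodd : Odd n)
    {M : DihedralGroup n →* Matrix (Fin 2) (Fin 2) K}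
    (hr : ∀ (k : ℕ) (c : K), M (r 1) ^ k = c • 1 → n ∣ k) (hs : ∀ c : K, M (sr 0) ≠ c • 1) :
    IsProjectivelyFaithful M := by
  have : NeZero n := ⟨hodd.pos.ne'⟩
  have hr' : ∀ (i : ZMod n) (c : K), M (r i) = c • 1 → i = 0 := fun i c h => by
    rw [← ZMod.natCast_zmod_val i, ← r_one_pow, map_pow] at h
    rw [← ZMod.natCast_zmod_val i, ZMod.natCast_eq_zero_iff]
    exact hr _ c h
  rintro (i | i) c h
  · rw [hr' i c h, r_zero]
  · exfalso
    have h1 : M (sr i) * M (r 1) = M (r 1) * M (sr i) := by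
      rw [h, smul_mul_assoc, mul_smul_comm, one_mul, mul_one]
    rw [← map_mul, ← map_mul, sr_mul_r, r_mul_sr] at h1
    have h2 : M (r (1 + 1)) = (1 : K) • 1 := by
      have h3 : (1 : ZMod n) + 1 = (i + 1) - (i - 1) := by ring
      rw [h3, ← sr_mul_sr, map_mul, h1, ← map_mul, sr_mul_self, map_one, one_smul]
    have h4 := hr' _ _ h2
    have h5 : n ∣ 2 := by
      rw [← ZMod.natCast_eq_zero_iff, Nat.cast_two, ← one_add_one_eq_two, h4]
    have h6 : n = 1 := by
      rcases (Nat.dvd_prime Nat.prime_two).mp h5 with h | h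
      · exact h
      · rw [h] at hodd
        exact absurd hodd (by decide)
    subst h6
    rw [Subsingleton.elim i 0] at h
    exact hs c h

/-- The representation on the regular polygon. -/
theorem exists_isProjectivelyFaithful_of_zetaAddInvMem {K : Type u} [Field K] {n : ℕ}
    (hodd : Odd n) (hζ : ZetaAddInvMem K n) :
    ∃ M : DihedralGroup n →* Matrix (Fin 2) (Fin 2) K, IsProjectivelyFaithful M := by
  have hB : (!![0, 1; 1, 0] : Matrix (Fin 2) (Fin 2) K) * !![0, 1; 1, 0] = 1 := by
    ext i j; fin_cases i <;> fin_cases j <;> simp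
  have hBs : ∀ c : K, (!![0, 1; 1, 0] : Matrix (Fin 2) (Fin 2) K) ≠ c • 1 := fun c h => by
    have := congrFun (congrFun h 0) 1
    simp at this
  -- For n = 1 the eigenvalues ζ and ζ⁻¹ coincide and the diagonalization below fails.
  rcases eq_or_ne n 1 with rfl | hn1
  · obtain ⟨M, h1, h2⟩ := exists_dihedral_hom_matrix one_pos (one_pow 1) hB
      (by rw [one_mul, mul_one])
    exact ⟨M, isProjectivelyFaithful_of_odd hodd (fun k _ _ => one_dvd k) (h2 ▸ hBs)⟩
  obtain ⟨ζ, hprim, a, ha⟩ := hζ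
  let f := algebraMap K (AlgebraicClosure K)
  have hζ0 : ζ ≠ 0 := hprim.ne_zero hodd.pos.ne'
  have hinv : ζ * ζ⁻¹ = 1 := mul_inv_cancel₀ hζ0
  have hdvd : ∀ k, ζ ^ k = ζ⁻¹ ^ k → n ∣ k := fun k hk => by
    have h1 : ζ ^ (2 * k) = 1 := by
      rw [two_mul, pow_add]
      nth_rewrite 2 [hk]
      rw [← mul_pow, hinv, one_pow]
    exact (Nat.Coprime.dvd_mul_left
      (Nat.coprime_two_right.mpr hodd)).mp (hprim.dvd_of_pow_eq_one _ h1)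
  have hne : ζ - ζ⁻¹ ≠ 0 := fun h => hn1 (Nat.dvd_one.mp (hdvd 1 (by
    rw [pow_one, pow_one]
    exact sub_eq_zero.mp h)))
  -- A is the companion matrix of X² − aX + 1, and the columns of P are its eigenvectors for ζ and
  -- ζ⁻¹. If A^k is scalar, then ζ^k = ζ^(−k), so n divides k because n is odd.
  let A : Matrix (Fin 2) (Fin 2) K := !![0, -1; 1, a]
  let P : Matrix (Fin 2) (Fin 2) (AlgebraicClosure K) := !![-1, -1; ζ, ζ⁻¹]
  have hAP : A.map f * P = P * Matrix.diagonal ![ζ, ζ⁻¹] := by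
    have haf : f a = ζ + ζ⁻¹ := ha
    ext i j
    fin_cases i <;> fin_cases j <;> simp [A, P, haf, Matrix.mul_apply]
    · linear_combination hinv
    · linear_combination hinv
  have hAkP : ∀ k : ℕ, (A ^ k).map f * P = P * Matrix.diagonal (![ζ, ζ⁻¹] ^ k) := fun k => by
    rw [← Matrix.diagonal_pow]
    induction k with
    | zero => simp
    | succ k ih => rw [pow_succ, Matrix.map_mul, mul_assoc, hAP, ← mul_assoc, ih, mul_assoc,
        ← pow_succ]
  have hP : IsUnit P := by
    rw [Matrix.isUnit_iff_isUnit_det, Matrix.det_fin_two]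
    exact IsUnit.mk0 _ (by simpa [P, sub_eq_neg_add, add_comm] using hne)
  have hAn : A ^ n = 1 := by
    refine Matrix.map_injective f.injective ?_
    change (A ^ n).map f = (1 : Matrix (Fin 2) (Fin 2) K).map f
    have h1 := hAkP n
    have h2 : (![ζ, ζ⁻¹] : Fin 2 → AlgebraicClosure K) ^ n = 1 := by
      ext i
      fin_cases i <;> simp [hprim.pow_eq_one]
    rw [h2, Matrix.diagonal_one', mul_one] at h1
    rw [Matrix.map_one _ (map_zero f) (map_one f)]
    exact hP.mul_right_cancel (by rw [h1, one_mul])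
  obtain ⟨M, h1, h2⟩ := exists_dihedral_hom_matrix hodd.pos hAn hB (by
    ext i j; fin_cases i <;> fin_cases j <;> simp [A])
  refine ⟨M, isProjectivelyFaithful_of_odd hodd (fun k c hk => hdvd k ?_) (h2 ▸ hBs)⟩
  have h3 := hAkP k
  rw [h1] at hk
  have h4 : (A ^ k).map f = f c • 1 := by
    rw [hk]
    ext i j; fin_cases i <;> fin_cases j <;> simp
  rw [h4, smul_mul_assoc, one_mul, ← mul_one P, ← mul_smul_comm, mul_one] at h3
  have h5 := hP.mul_left_cancel h3
  have e0 := congrFun (congrFun h5 0) 0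
  have e1 := congrFun (congrFun h5 1) 1
  simp at e0 e1
  rw [← e0, e1, inv_pow]

/-- The affine group of the prime field. -/
theorem exists_isProjectivelyFaithful_prime {K : Type u} [Field K] {p : ℕ} (hp : p.Prime)
    (hodd : Odd p) [CharP K p] :
    ∃ M : DihedralGroup p →* Matrix (Fin 2) (Fin 2) K, IsProjectivelyFaithful M := by
  have hpow : ∀ k : ℕ, (!![1, 1; 0, 1] : Matrix (Fin 2) (Fin 2) K) ^ k = !![1, (k : K); 0, 1] :=
    fun k => by
      induction k with
      | zero => ext i j; fin_cases i <;> fin_cases j <;> simp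
      | succ k ih =>
        rw [pow_succ, ih]
        ext i j; fin_cases i <;> fin_cases j <;> simp [add_comm]
  have h2 : (1 : K) ≠ -1 := fun h => by
    have h3 : ((2 : ℕ) : K) = 0 := by
      push_cast
      linear_combination h
    rw [CharP.cast_eq_zero_iff K p, Nat.prime_dvd_prime_iff_eq hp Nat.prime_two] at h3
    rw [h3] at hodd
    exact absurd hodd (by decide)
  obtain ⟨M, hA, hB⟩ := exists_dihedral_hom_matrix (n := p) (A := !![1, 1; 0, 1])
    (B := (!![1, 0; 0, -1] : Matrix (Fin 2) (Fin 2) K)) hp.pos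
    (by rw [hpow, CharP.cast_eq_zero]; ext i j; fin_cases i <;> fin_cases j <;> simp)
    (by ext i j; fin_cases i <;> fin_cases j <;> simp)
    (by ext i j; fin_cases i <;> fin_cases j <;> simp)
  refine ⟨M, isProjectivelyFaithful_of_odd hodd (fun k c hk => ?_) fun c hc => ?_⟩
  · rw [hA, hpow] at hk
    have := congrFun (congrFun hk 0) 1
    simp at this
    exact (CharP.cast_eq_zero_iff K p k).mp this
  · rw [hB] at hc
    have e0 := congrFun (congrFun hc 0) 0
    have e1 := congrFun (congrFun hc 1) 1
    simp at e0 e1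
    exact h2 (e0.trans e1.symm)

/-- The Klein four-group as a group of translations. -/
theorem exists_isProjectivelyFaithful_two {K : Type u} [Field K] [CharP K 2]
    (hK : 4 ≤ Cardinal.mk K) :
    ∃ M : DihedralGroup 2 →* Matrix (Fin 2) (Fin 2) K, IsProjectivelyFaithful M := by
  classical
  obtain ⟨x, hx⟩ : ∃ x : K, x ∉ ({0, 1} : Finset K) := by
    by_contra! h
    have h1 : Cardinal.mk K ≤ (({0, 1} : Finset K).card : Cardinal) := by
      rw [← Cardinal.mk_coe_finset]
      exact Cardinal.mk_le_of_injective (f := fun x => ⟨x, h x⟩) fun a b hab =>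
        congrArg Subtype.val hab
    have h2 := (hK.trans h1).trans (Nat.cast_le.mpr Finset.card_le_two)
    exact absurd (Nat.cast_le.mp (by exact_mod_cast h2 : ((4 : ℕ) : Cardinal.{u}) ≤ (2 : ℕ)))
      (by decide)
  simp only [Finset.mem_insert, Finset.mem_singleton, not_or] at hx
  have h2 : (1 : K) + 1 = 0 := CharTwo.add_self_eq_zero 1
  -- The three nontrivial elements act as translations by 1, x and 1 + x, all nonzero since x is
  -- neither 0 nor 1.
  obtain ⟨M, hA, hB⟩ := exists_dihedral_hom_matrix (n := 2) (A := !![1, 1; 0, 1])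
    (B := (!![1, x; 0, 1] : Matrix (Fin 2) (Fin 2) K)) two_pos
    (by rw [pow_two]; ext i j; fin_cases i <;> fin_cases j <;> simp [h2])
    (by ext i j; fin_cases i <;> fin_cases j <;> simp [CharTwo.add_self_eq_zero])
    (by
      ext i j
      fin_cases i <;> fin_cases j <;> simp
      linear_combination h2)
  refine ⟨M, ?_⟩
  have hAB : M (sr 1) = !![1, 1 + x; 0, 1] := by
    rw [← zero_add (1 : ZMod 2), ← sr_mul_r, map_mul, hA, hB]
    ext i j; fin_cases i <;> fin_cases j <;> simp
  have hcase : ∀ i : ZMod 2, i = 0 ∨ i = 1 := by decide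
  rintro (i | i) c h <;> obtain rfl | rfl := hcase i
  · rfl
  · rw [hA] at h
    have := congrFun (congrFun h 0) 1
    simp at this
  · rw [hB] at h
    have := congrFun (congrFun h 0) 1
    simp [hx.1] at this
  · rw [hAB] at h
    have := congrFun (congrFun h 0) 1
    simp at this
    exact absurd (by linear_combination this - h2) hx.2

end

end EssDim

/-! ### The classification -/

theorem theorem1p4 (K : Type u) [Field K] (n : ℕ) (hn : 0 < n)
    (V : Type v) [AddCommGroup V] [Module K V] [FiniteDimensional K V]
    (ρ : Representation K (DihedralGroup n) V) (hρ : Function.Injective ρ) :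
    (CharZero K → (EssDim.ed ρ = 1 ↔ Odd n ∧ EssDim.ZetaAddInvMem K n)) ∧
    (∀ p : ℕ, p.Prime → p ≠ 2 → CharP K p →
      (EssDim.ed ρ = 1 ↔
        Odd n ∧ (¬ p ∣ n → EssDim.ZetaAddInvMem K n) ∧ (p ∣ n → n = p))) ∧
    (CharP K 2 →
      (EssDim.ed ρ = 1 ↔
        (Odd n ∧ EssDim.ZetaAddInvMem K n) ∨
        (Even n ∧ n = 2 ∧ 4 ≤ Cardinal.mk K))) := by
  have : NeZero n := ⟨hn.ne'⟩
  -- Even for n = 1 the group has two elements, so the criterion applies to every n.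
  have : Nontrivial (DihedralGroup n) := ⟨DihedralGroup.r 0, DihedralGroup.sr 0, nofun⟩
  rw [EssDim.ed_eq_one_iff ρ hρ]
  refine ⟨fun _ => ⟨?_, ?_⟩, fun p hp hp2 _ => ⟨?_, ?_⟩, fun _ => ⟨?_, ?_⟩⟩
  · rintro ⟨M, hM⟩
    have hodd := hM.odd_of_two_ne_zero hn two_ne_zero
    exact ⟨hodd, hM.zetaAddInvMem hodd (Nat.cast_ne_zero.mpr hn.ne')⟩
  · exact fun h => EssDim.exists_isProjectivelyFaithful_of_zetaAddInvMem h.1 h.2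
  · rintro ⟨M, hM⟩
    have hodd := hM.odd_of_two_ne_zero hn (Ring.two_ne_zero (by rwa [ringChar.eq K p]))
    exact ⟨hodd, fun h => hM.zetaAddInvMem hodd (by rwa [Ne, CharP.cast_eq_zero_iff K p]),
      hM.eq_char_of_dvd hn hp⟩
  · rintro ⟨hodd, h1, h2⟩
    by_cases hpn : p ∣ n
    · obtain rfl := h2 hpn
      exact EssDim.exists_isProjectivelyFaithful_prime hp hodd
    · exact EssDim.exists_isProjectivelyFaithful_of_zetaAddInvMem hodd (h1 hpn)
  · rintro ⟨M, hM⟩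
    rcases Nat.even_or_odd n with heven | hodd
    · obtain rfl := hM.eq_char_of_dvd hn Nat.prime_two heven.two_dvd
      exact Or.inr ⟨heven, rfl, hM.four_le_mk⟩
    · refine Or.inl ⟨hodd, hM.zetaAddInvMem hodd ?_⟩
      rw [Ne, CharP.cast_eq_zero_iff K 2]
      exact hodd.not_two_dvd_nat
  · rintro (⟨hodd, h⟩ | ⟨-, rfl, h⟩)
    · exact EssDim.exists_isProjectivelyFaithful_of_zetaAddInvMem hodd h
    · exact EssDim.exists_isProjectivelyFaithful_two h
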